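/- **Gluing state designs with phase operators.** For a finite set $Q$ of qubits, an *ensemble* on $Q$ is a probability measure $\mathcal S$ on the unit sphere of $\mathbb C^{2^{|Q|}}$ (pure states), with $k$-th moment $\chi_{\mathcal S}=\mathbb E_{\phi\sim\mathcal S}\,(|\phi\rangle\langle\phi|)^{\otimes k}$; $\mathcal S$ is an *$\varepsilon$-approximate state $k$-design* if $\|\chi_{\mathcal S}-\chi_H\|_1\le\varepsilon$, where $\chi_H$ is the $k$-th moment of the Haar (uniform) measure on the unit sphere and $\|\cdot\|_1$ is the trace norm (sum of the singular values). There is an absolute constant $C>0$ with the following property. Let $k,\xi\ge 0$ be integers, let $A,B$ be disjoint finite sets of qubits with $|A|,|B|\ge\xi$, and choose $\Xi_A\subseteq A$, $\Xi_B\subseteq B$ with $|\Xi_A|=|\Xi_B|=\xi$. Let $\mathcal S_A$, $\mathcal S_B$ be $\varepsilon_A$- and $\varepsilon_B$-approximate state $k$-designs on $A$ and $B$. Let $f$ be a random Boolean function on $\{0,1\}^{\Xi_A\sqcup\Xi_B}$ that is $2k$-wise independent, i.e. $\Pr[f(x_1)=y_1,\dots,f(x_{2k})=y_{2k}]=2^{-2k}$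 for all distinct inputs $x_1,\dots,x_{2k}$ and all bits $y_1,\dots,y_{2k}$ (for example, a uniformly random function), and let $F_f=\sum_z(-1)^{f(z)}|z\rangle\langle z|$ be the corresponding phase operator on $\Xi_A\sqcup\Xi_B$. Then the ensemble of states $(F_f\otimes \mathbb 1)(|\phi_A\rangle\otimes|\phi_B\rangle)$ on $A\sqcup B$, with $\phi_A\sim\mathcal S_A$, $\phi_B\sim\mathcal S_B$ and $f$ independent, is an $\varepsilon$-approximate state $k$-design with $$\varepsilon=\varepsilon_A+\varepsilon_B+C\,\frac{k^2}{2^{\xi}} .$$ No relation between $k$ and $\xi$ is required; in particular the bound holds in the regime $k=o(2^{\xi/2})$. -/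

import Mathlib

/-!
Restrict attention to the `k`-tuples `x` of bitstrings on `A ⊔ B` whose members have pairwise
distinct restrictions to `ΞA` and pairwise distinct restrictions to `ΞB`. Invariance of the Haar
measure under coordinate phases makes its moment vanish off the pairs `(x, x ∘ π)`, and invariance
under coordinate permutations makes it constant on these pairs for injective `x`. Before the phase
operator is applied, the product of the Haar moments on `A` and `B` is supported on pairs permuted
by some `σ` on `A` and some `τ` on `B`; averaging over `2k`-wise independent signs kills the pairs
with `σ ≠ τ`. Hence, on these rows, both the glued moment of the Haar ensembles and the Haar moment
of `A ⊔ B` are scalar multiples of one and the same positive semidefinite matrix. Both have trace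
one and, by a union bound over collisions, diagonal mass `O(k² / 2^ξ)` on the remaining rows, so
they are `O(k² / 2^ξ)`-close in trace norm. Replacing the designs by Haar ensembles costs `εA + εB`,
because gluing is positive and trace preserving.
-/

open MeasureTheory

noncomputable section

namespace QDesign

/-- Bitstrings on the qubits `Q`; they label the computational basis of `Q`. -/
abbrev Bits (Q : Type) : Type := Q → Bool

/-- Pure states of the qubits `Q`: unit vectors of `ℂ^{2^|Q|}`. -/
abbrev PureState (Q : Type) [Fintype Q] [DecidableEq Q] : Type :=
  Metric.sphere (0 : EuclideanSpace ℂ (Bits Q)) 1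

/-- The trace norm `‖M‖₁ = Tr √(Mᴴ M)`: the sum of the singular values of `M`. -/
def traceNorm {ι : Type} [Fintype ι] [DecidableEq ι] (M : Matrix ι ι ℂ) : ℝ :=
  ∑ i, √((Matrix.isHermitian_conjTranspose_mul_self M).eigenvalues i)

section Ensembles

variable {Q : Type} [Fintype Q] [DecidableEq Q]

/-- The rank-one projector `|φ⟩⟨φ|`. -/
def projector (φ : PureState Q) : Matrix (Bits Q) (Bits Q) ℂ :=
  Matrix.of fun x y => φ.1 x * star (φ.1 y)

/-- The `k`-fold tensor power `ρ^{⊗k}` on `k` copies, in the computational basis. -/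
def tensorPower (k : ℕ) (ρ : Matrix (Bits Q) (Bits Q) ℂ) :
    Matrix (Fin k → Bits Q) (Fin k → Bits Q) ℂ :=
  Matrix.of fun x y => ∏ j, ρ (x j) (y j)

/-- The `k`-th moment `χ_S = 𝔼_{φ ∼ S} (|φ⟩⟨φ|)^{⊗k}` of an ensemble of pure states
(the expectation is taken entrywise). -/
def moment (k : ℕ) (S : Measure (PureState Q)) :
    Matrix (Fin k → Bits Q) (Fin k → Bits Q) ℂ :=
  Matrix.of fun x y => ∫ φ, tensorPower k (projector φ) x y ∂S

variable (Q) in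
/-- The Haar ensemble: the uniform probability measure on the unit sphere of `ℂ^{2^|Q|}`. -/
def haarEnsemble : Measure (PureState Q) :=
  ((volume : Measure (EuclideanSpace ℂ (Bits Q))).toSphere Set.univ)⁻¹ •
    (volume : Measure (EuclideanSpace ℂ (Bits Q))).toSphere

instance haarEnsemble.instIsProbabilityMeasure :
    IsProbabilityMeasure (haarEnsemble Q) := by
  have : NeZero ((volume : Measure (EuclideanSpace ℂ (Bits Q))).toSphere) :=
    ⟨Measure.toSphere_ne_zero _⟩
  exact isProbabilityMeasureSMul

/-- `S` is an `ε`-approximate state `k`-design: `‖χ_S - χ_H‖₁ ≤ ε`. -/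
def IsApproxStateDesign (k : ℕ) (ε : ℝ) (S : Measure (PureState Q)) : Prop :=
  traceNorm (moment k S - moment k (haarEnsemble Q)) ≤ ε

end Ensembles

/-- A random Boolean function on `X`, with law `ν`, is `t`-wise independent: its values at any `t`
distinct inputs are independent and uniform. -/
def IsWiseIndependent {X : Type} (t : ℕ) (ν : Measure (X → Bool)) : Prop :=
  ∀ x : Fin t → X, Function.Injective x → ∀ y : Fin t → Bool,
    ν.real {f | ∀ i, f (x i) = y i} = ((2 : ℝ) ^ t)⁻¹

section Gluing

variable {A B : Type} [Fintype A] [DecidableEq A] [Fintype B] [DecidableEq B]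

/-- The restriction of a bitstring on `A ⊔ B` to the qubits `ΞA ⊔ ΞB`. -/
def restrictBits (ΞA : Finset A) (ΞB : Finset B) (z : Bits (A ⊕ B)) : Bits (ΞA ⊕ ΞB) :=
  fun q => z (Sum.map Subtype.val Subtype.val q)

/-- The product state `|φ⟩ ⊗ |ψ⟩` on `A ⊔ B`. -/
def tensorState (φ : PureState A) (ψ : PureState B) : PureState (A ⊕ B) :=
  ⟨WithLp.toLp 2 fun z : Bits (A ⊕ B) => φ.1 (z ∘ Sum.inl) * ψ.1 (z ∘ Sum.inr), by
    have hφ : ∑ x, ‖φ.1 x‖ ^ 2 = 1 := by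
      rw [← EuclideanSpace.norm_sq_eq, norm_eq_of_mem_sphere]; norm_num
    have hψ : ∑ x, ‖ψ.1 x‖ ^ 2 = 1 := by
      rw [← EuclideanSpace.norm_sq_eq, norm_eq_of_mem_sphere]; norm_num
    rw [mem_sphere_zero_iff_norm, EuclideanSpace.norm_eq, Real.sqrt_eq_one]
    simp only [norm_mul, mul_pow]
    rw [← (Equiv.sumArrowEquivProdArrow A B Bool).symm.sum_comp, Fintype.sum_prod_type]
    calc _ = ∑ x : Bits A, ∑ y : Bits B, ‖φ.1 x‖ ^ 2 * ‖ψ.1 y‖ ^ 2 := rfl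
      _ = 1 := by simp_rw [← Finset.mul_sum, hψ, mul_one, hφ]⟩

/-- The phase operator `F_f = ∑_z (-1)^{f(z)} |z⟩⟨z|` of a Boolean function `f` of the bits on
`ΞA ⊔ ΞB`, tensored with the identity on the other qubits and applied to a state on `A ⊔ B`. -/
def applyPhase (ΞA : Finset A) (ΞB : Finset B) (f : Bits (ΞA ⊕ ΞB) → Bool)
    (φ : PureState (A ⊕ B)) : PureState (A ⊕ B) :=
  ⟨WithLp.toLp 2 fun z : Bits (A ⊕ B) => (-1) ^ (f (restrictBits ΞA ΞB z)).toNat * φ.1 z, by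
    have h : ‖φ.1‖ = 1 := norm_eq_of_mem_sphere φ
    rw [EuclideanSpace.norm_eq] at h
    rw [mem_sphere_zero_iff_norm, EuclideanSpace.norm_eq]
    simpa using h⟩

/-- The ensemble of the states `F_f (|φ⟩ ⊗ |ψ⟩)`, where `φ ∼ SA`, `ψ ∼ SB` and the Boolean
function `f ∼ ν` are independent. -/
def gluedEnsemble (ΞA : Finset A) (ΞB : Finset B) (SA : Measure (PureState A))
    (SB : Measure (PureState B)) (ν : Measure (Bits (ΞA ⊕ ΞB) → Bool)) :
    Measure (PureState (A ⊕ B)) :=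
  ((SA.prod SB).prod ν).map fun p => applyPhase ΞA ΞB p.2 (tensorState p.1.1 p.1.2)

/-- The map that defines the glued ensemble is measurable. -/
theorem measurable_glue (ΞA : Finset A) (ΞB : Finset B) :
    Measurable fun p : (PureState A × PureState B) × (Bits (ΞA ⊕ ΞB) → Bool) =>
      applyPhase ΞA ΞB p.2 (tensorState p.1.1 p.1.2) := by
  refine Measurable.subtype_mk ?_
  refine (WithLp.measurable_toLp 2 _).comp (measurable_pi_lambda _ fun z => ?_)
  refine Measurable.mul ?_ (Measurable.mul ?_ ?_)
  · exact (measurable_of_countable fun b : Bool => ((-1 : ℂ)) ^ b.toNat).comp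
      ((measurable_pi_apply _).comp measurable_snd)
  · exact (by fun_prop : Continuous fun φ : PureState A => φ.1 (z ∘ Sum.inl)).measurable.comp
      (measurable_fst.comp measurable_fst)
  · exact (by fun_prop : Continuous fun φ : PureState B => φ.1 (z ∘ Sum.inr)).measurable.comp
      (measurable_snd.comp measurable_fst)

instance gluedEnsemble.instIsProbabilityMeasure (ΞA : Finset A) (ΞB : Finset B)
    (SA : Measure (PureState A)) [IsProbabilityMeasure SA]
    (SB : Measure (PureState B)) [IsProbabilityMeasure SB]
    (ν : Measure (Bits (ΞA ⊕ ΞB) → Bool)) [IsProbabilityMeasure ν] :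
    IsProbabilityMeasure (gluedEnsemble ΞA ΞB SA SB ν) :=
  Measure.isProbabilityMeasure_map (measurable_glue ΞA ΞB).aemeasurable

end Gluing

end QDesign

end

noncomputable section

namespace QDesign

open scoped Matrix ComplexOrder

section TraceNorm

variable {ι κ : Type} [Fintype ι] [Fintype κ]

theorem posSemidef_sub_smul_of_rows {D : ι → Prop} [DecidablePred D] {M T : Matrix ι ι ℂ}
    (hM : M.PosSemidef) (hT : T.IsHermitian) {c : ℝ}
    (hMT : ∀ x, D x → ∀ y, M x y = c * T x y) (hT₀ : ∀ x, ¬D x → ∀ y, T x y = 0) :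
    (M - c • T).PosSemidef ∧ (M - c • T).trace = ∑ x with ¬D x, M x x := by
  classical
  let E : Matrix ι ι ℂ := Matrix.diagonal fun x => if D x then 0 else 1
  have hentry (x y : ι) : (M - c • T) x y = if D x ∨ D y then 0 else M x y := by
    have hrow {x y : ι} (hx : D x) : (M - c • T) x y = 0 := by simp [hMT x hx]
    by_cases hx : D x
    · simp [hx, hrow hx]
    by_cases hy : D y
    · have hHerm : (M - c • T).IsHermitian := hM.1.sub (hT.smul (by simp [IsSelfAdjoint]))
      rw [← hHerm.apply, hrow hy]
      simp [hy]
    · simp [hx, hy, hT₀ x hx]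
  constructor
  · convert hM.conjTranspose_mul_mul_same E using 1
    ext x y
    rw [hentry, Matrix.diagonal_conjTranspose, Matrix.mul_diagonal, Matrix.diagonal_mul]
    by_cases hx : D x <;> by_cases hy : D y <;> simp [hx, hy]
  · rw [Matrix.trace, Finset.sum_filter]
    refine Finset.sum_congr rfl fun x _ => ?_
    rw [Matrix.diag_apply, hentry]
    by_cases hx : D x <;> simp [hx]

variable [DecidableEq ι] [DecidableEq κ]

theorem traceNorm_eq_sum_abs_eigenvalues {M : Matrix ι ι ℂ} (hM : M.IsHermitian) :
    traceNorm M = ∑ i, |hM.eigenvalues i| := by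
  have hsq : Mᴴ * M = cfc (fun x : ℝ => x ^ 2) M := by
    rw [cfc_pow_id (R := ℝ) M 2 hM.isSelfAdjoint, hM.eq, pow_two]
  have hroots : (Mᴴ * M).charpoly.roots =
      Finset.univ.val.map fun i => ((hM.eigenvalues i ^ 2 : ℝ) : ℂ) := by
    rw [hsq, hM.charpoly_cfc_eq (fun x : ℝ => x ^ 2), Polynomial.roots_prod _ _
      (Finset.prod_ne_zero_iff.2 fun i _ => Polynomial.X_sub_C_ne_zero _)]
    simp only [Polynomial.roots_X_sub_C, Multiset.bind_singleton]
    rfl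
  have hsum := congrArg (fun s : Multiset ℂ => (s.map fun z => √z.re).sum)
    ((Matrix.isHermitian_conjTranspose_mul_self M).roots_charpoly_eq_eigenvalues.symm.trans hroots)
  simpa [Multiset.map_map, Function.comp_def, Real.sqrt_sq_eq_abs, traceNorm,
    ← Complex.ofReal_pow] using hsum

theorem traceNorm_sub_le {P N : Matrix ι ι ℂ} (hP : P.PosSemidef) (hN : N.PosSemidef) :
    traceNorm (P - N) ≤ P.trace.re + N.trace.re := by
  have hM : (P - N).IsHermitian := hP.1.sub hN.1
  set U : Matrix ι ι ℂ := (hM.eigenvectorUnitary : Matrix ι ι ℂ)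
  have htrace (X : Matrix ι ι ℂ) : (Uᴴ * X * U).trace = X.trace := by
    have hU : U * Uᴴ = 1 := Unitary.coe_mul_star_self hM.eigenvectorUnitary
    rw [Matrix.trace_mul_cycle, hU, one_mul]
  have hnonneg {X : Matrix ι ι ℂ} (hX : X.PosSemidef) (i : ι) : 0 ≤ ((Uᴴ * X * U) i i).re :=
    (Complex.le_def.1 (hX.conjTranspose_mul_mul_same U).diag_nonneg).1
  have heigenvalue (i : ι) :
      hM.eigenvalues i = ((Uᴴ * P * U) i i).re - ((Uᴴ * N * U) i i).re := by
    have hdiag : Uᴴ * (P - N) * U = Matrix.diagonal (RCLike.ofReal ∘ hM.eigenvalues) := by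
      rw [← hM.conjStarAlgAut_star_eigenvectorUnitary, Unitary.conjStarAlgAut_star_apply]
      rfl
    simpa [mul_sub, sub_mul] using congrArg (fun X : Matrix ι ι ℂ => (X i i).re) hdiag.symm
  calc
    traceNorm (P - N) = ∑ i, |hM.eigenvalues i| := traceNorm_eq_sum_abs_eigenvalues hM
    _ ≤ ∑ i, (((Uᴴ * P * U) i i).re + ((Uᴴ * N * U) i i).re) := by
      gcongr with i
      rw [heigenvalue, abs_le]
      constructor <;> linarith [hnonneg hP i, hnonneg hN i]
    _ = P.trace.re + N.trace.re := by
      rw [Finset.sum_add_distrib, ← Complex.re_sum, ← Complex.re_sum, ← htrace P, ← htrace N]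
      rfl

theorem exists_posSemidef_sub_eq {M : Matrix ι ι ℂ} (hM : M.IsHermitian) :
    ∃ P N : Matrix ι ι ℂ, P.PosSemidef ∧ N.PosSemidef ∧ P - N = M ∧
      P.trace.re + N.trace.re = traceNorm M := by
  set U : Matrix ι ι ℂ := (hM.eigenvectorUnitary : Matrix ι ι ℂ)
  let conj (d : ι → ℝ) : Matrix ι ι ℂ := U * Matrix.diagonal (fun i => (d i : ℂ)) * Uᴴ
  have conj_posSemidef {d : ι → ℝ} (hd : ∀ i, 0 ≤ d i) : (conj d).PosSemidef :=
    (Matrix.PosSemidef.diagonal fun i => by simpa using hd i).mul_mul_conjTranspose_same U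
  have trace_conj (d : ι → ℝ) : (conj d).trace.re = ∑ i, d i := by
    have hU : Uᴴ * U = 1 := Unitary.coe_star_mul_self hM.eigenvectorUnitary
    rw [Matrix.trace_mul_cycle, hU, one_mul, Matrix.trace_diagonal, Complex.re_sum]
    simp only [Complex.ofReal_re]
  refine ⟨conj fun i => (hM.eigenvalues i)⁺, conj fun i => (hM.eigenvalues i)⁻,
    conj_posSemidef fun i => posPart_nonneg _, conj_posSemidef fun i => negPart_nonneg _, ?_, ?_⟩
  · conv_rhs => rw [hM.spectral_theorem, Unitary.conjStarAlgAut_apply]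
    rw [← sub_mul, ← mul_sub, Matrix.diagonal_sub]
    congr 3
    ext i
    rw [← Complex.ofReal_sub, posPart_sub_negPart]
    rfl
  · simp only [trace_conj, ← Finset.sum_add_distrib, posPart_add_negPart,
      traceNorm_eq_sum_abs_eigenvalues hM]

theorem traceNorm_add_le {M N : Matrix ι ι ℂ} (hM : M.IsHermitian) (hN : N.IsHermitian) :
    traceNorm (M + N) ≤ traceNorm M + traceNorm N := by
  obtain ⟨P, P', hP, hP', rfl, htM⟩ := exists_posSemidef_sub_eq hM
  obtain ⟨R, R', hR, hR', rfl, htN⟩ := exists_posSemidef_sub_eq hN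
  have := traceNorm_sub_le (hP.add hR) (hP'.add hR')
  rw [Matrix.trace_add, Matrix.trace_add, Complex.add_re, Complex.add_re] at this
  rw [sub_add_sub_comm]
  linarith

theorem traceNorm_map_le (Φ : Matrix ι ι ℂ →+ Matrix κ κ ℂ)
    (hΦ : ∀ P, P.PosSemidef → (Φ P).PosSemidef)
    (htr : ∀ P, P.PosSemidef → (Φ P).trace.re ≤ P.trace.re)
    {M : Matrix ι ι ℂ} (hM : M.IsHermitian) : traceNorm (Φ M) ≤ traceNorm M := by
  obtain ⟨P, N, hP, hN, rfl, hPN⟩ := exists_posSemidef_sub_eq hM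
  calc
    traceNorm (Φ (P - N)) ≤ (Φ P).trace.re + (Φ N).trace.re := by
      rw [map_sub]
      exact traceNorm_sub_le (hΦ P hP) (hΦ N hN)
    _ ≤ P.trace.re + N.trace.re := add_le_add (htr P hP) (htr N hN)
    _ = traceNorm (P - N) := hPN

/-- If `d ≤ c`, then `M - N` is the difference of `(c - d) • T + (M - c • T)` and `N - d • T`; these
are positive semidefinite of equal trace. -/
theorem traceNorm_sub_le_of_rows {D : ι → Prop} [DecidablePred D] {M N T : Matrix ι ι ℂ}
    (hM : M.PosSemidef) (hN : N.PosSemidef) (hT : T.PosSemidef) (htr : M.trace = N.trace)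
    {c d : ℝ} (hMT : ∀ x, D x → ∀ y, M x y = c * T x y)
    (hNT : ∀ x, D x → ∀ y, N x y = d * T x y) (hT₀ : ∀ x, ¬D x → ∀ y, T x y = 0)
    {δ : ℝ} (hMδ : ∑ x with ¬D x, (M x x).re ≤ δ) (hNδ : ∑ x with ¬D x, (N x x).re ≤ δ) :
    traceNorm (M - N) ≤ 2 * δ := by
  obtain ⟨hM', hMtr⟩ := posSemidef_sub_smul_of_rows hM hT.1 hMT hT₀
  obtain ⟨hN', hNtr⟩ := posSemidef_sub_smul_of_rows hN hT.1 hNT hT₀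
  rw [← Complex.re_sum] at hMδ hNδ
  rw [← hMtr] at hMδ
  rw [← hNtr] at hNδ
  have hbound {P R : Matrix ι ι ℂ} (hP : P.PosSemidef) (hR : R.PosSemidef) (h : M - N = P - R) :
      traceNorm (M - N) ≤ 2 * P.trace.re ∧ traceNorm (M - N) ≤ 2 * R.trace.re := by
    have htrPR : P.trace = R.trace := by
      rw [← sub_eq_zero, ← Matrix.trace_sub, ← h, Matrix.trace_sub, htr, sub_self]
    have := h ▸ traceNorm_sub_le hP hR
    constructor <;> linarith [congrArg Complex.re htrPR]
  obtain hdc | hcd := le_total d c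
  · refine (hbound ((hT.smul (sub_nonneg.2 hdc)).add hM') hN' (by module)).2.trans ?_
    linarith
  · refine (hbound hM' ((hT.smul (sub_nonneg.2 hcd)).add hN') (by module)).1.trans ?_
    linarith

end TraceNorm

section SphereInvariance

open Metric
open scoped Pointwise RealInnerProductSpace

/-- The action of a linear isometry on the unit sphere. -/
def sphereHomeomorph {E : Type*} [NormedAddCommGroup E] [NormedSpace ℝ E] (U : E ≃ₗᵢ[ℝ] E) :
    sphere (0 : E) 1 ≃ₜ sphere (0 : E) 1 :=
  U.toHomeomorph.subtype fun v => by simp [LinearIsometryEquiv.toHomeomorph]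

theorem measurePreserving_sphereHomeomorph {E : Type*} [NormedAddCommGroup E] [NormedSpace ℝ E]
    [MeasurableSpace E] [BorelSpace E] {μ : Measure E} {U : E ≃ₗᵢ[ℝ] E}
    (hU : MeasurePreserving U μ μ) :
    MeasurePreserving (sphereHomeomorph U) μ.toSphere μ.toSphere := by
  have hmeas := (sphereHomeomorph U).continuous.measurable
  refine ⟨hmeas, Measure.ext fun s hs => ?_⟩
  have hcone : Set.Ioo (0 : ℝ) 1 • (Subtype.val '' (sphereHomeomorph U ⁻¹' s)) =
      U ⁻¹' (Set.Ioo (0 : ℝ) 1 • (Subtype.val '' s)) := by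
    have hpreimage (t : Set E) : U ⁻¹' t = U.symm '' t := (U.symm.image_eq_preimage_symm t).symm
    rw [← (sphereHomeomorph U).image_symm, hpreimage, ← Set.image2_smul, ← Set.image2_smul,
      Set.image_image2_distrib_right fun r v => U.symm.map_smul r v,
      Set.image_image, Set.image_image]
    rfl
  rw [Measure.map_apply hmeas hs, Measure.toSphere_apply' _ hs,
    Measure.toSphere_apply' _ (hmeas hs), hcone,
    hU.measure_preimage_emb U.toHomeomorph.measurableEmbedding]

variable {E : Type*} [NormedAddCommGroup E] [InnerProductSpace ℝ E] [MeasurableSpace E]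

/-- A measure on the unit sphere is isometry-invariant if every linear isometry preserves it. -/
def IsIsometryInvariant (μ : Measure (sphere (0 : E) 1)) : Prop :=
  ∀ U : E ≃ₗᵢ[ℝ] E, MeasurePreserving (sphereHomeomorph U) μ μ

namespace IsIsometryInvariant

variable [BorelSpace E] {μ : Measure (sphere (0 : E) 1)}

theorem integral_comp {F : Type*} [NormedAddCommGroup F] [NormedSpace ℝ F]
    (hμ : IsIsometryInvariant μ) (U : E ≃ₗᵢ[ℝ] E) (f : E → F) :
    ∫ φ, f (U φ.1) ∂μ = ∫ φ, f φ.1 ∂μ :=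
  (hμ U).integral_comp (sphereHomeomorph U).measurableEmbedding fun φ => f φ.1

theorem integral_inner_pow_four (hμ : IsIsometryInvariant μ) {e : E} (he : ‖e‖ = 1) (v : E) :
    ∫ φ, ⟪v, φ.1⟫ ^ 4 ∂μ = ‖v‖ ^ 4 * ∫ φ, ⟪e, φ.1⟫ ^ 4 ∂μ := by
  let U := (ℝ ∙ (v - ‖v‖ • e))ᗮ.reflection
  have hU : U v = ‖v‖ • e := Submodule.reflection_sub (by simp [norm_smul, he])
  calc
    ∫ φ, ⟪v, φ.1⟫ ^ 4 ∂μ = ∫ φ, ⟪U v, U φ.1⟫ ^ 4 ∂μ := by simp only [U.inner_map_map]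
    _ = ∫ φ, ⟪‖v‖ • e, φ.1⟫ ^ 4 ∂μ := by rw [hU, hμ.integral_comp U fun φ => ⟪‖v‖ • e, φ⟫ ^ 4]
    _ = ‖v‖ ^ 4 * ∫ φ, ⟪e, φ.1⟫ ^ 4 ∂μ := by
      simp only [real_inner_smul_left, mul_pow, integral_const_mul]

end IsIsometryInvariant

theorem integrable_of_continuous {X F : Type*} [NormedAddCommGroup F] [TopologicalSpace X]
    [CompactSpace X] [MeasurableSpace X] [OpensMeasurableSpace X] {μ : Measure X}
    [IsFiniteMeasure μ] {f : X → F} (hf : Continuous f) :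
    Integrable f μ :=
  hf.integrable_of_hasCompactSupport (.of_compactSpace f)

/-- Polarization: `12 s² t² = (s + t)⁴ + (s - t)⁴ - 2 s⁴ - 2 t⁴`. -/
theorem IsIsometryInvariant.integral_inner_sq_mul_inner_sq [BorelSpace E] [FiniteDimensional ℝ E]
    {μ : Measure (sphere (0 : E) 1)} [IsFiniteMeasure μ] (hμ : IsIsometryInvariant μ)
    {e : E} (he : ‖e‖ = 1) (v w : E) :
    ∫ φ, ⟪v, φ.1⟫ ^ 2 * ⟪w, φ.1⟫ ^ 2 ∂μ =
      (‖v‖ ^ 2 * ‖w‖ ^ 2 + 2 * ⟪v, w⟫ ^ 2) / 3 * ∫ φ, ⟪e, φ.1⟫ ^ 4 ∂μ := by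
  have hint {f : sphere (0 : E) 1 → ℝ} (hf : Continuous f) : Integrable f μ :=
    integrable_of_continuous hf
  have hpolar : ∫ φ, 12 * (⟪v, φ.1⟫ ^ 2 * ⟪w, φ.1⟫ ^ 2) ∂μ =
      ∫ φ, (⟪v + w, φ.1⟫ ^ 4 + ⟪v - w, φ.1⟫ ^ 4 - 2 * ⟪v, φ.1⟫ ^ 4 - 2 * ⟪w, φ.1⟫ ^ 4) ∂μ := by
    congr 1 with φ
    simp only [inner_add_left, inner_sub_left]
    ring
  rw [integral_const_mul, integral_sub (hint (by fun_prop)) (hint (by fun_prop)),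
    integral_sub (hint (by fun_prop)) (hint (by fun_prop)),
    integral_add (hint (by fun_prop)) (hint (by fun_prop)), integral_const_mul,
    integral_const_mul] at hpolar
  have hsum : ‖v + w‖ ^ 4 = (‖v‖ ^ 2 + 2 * ⟪v, w⟫ + ‖w‖ ^ 2) ^ 2 := by
    rw [← norm_add_sq_real]; ring
  have hdiff : ‖v - w‖ ^ 4 = (‖v‖ ^ 2 - 2 * ⟪v, w⟫ + ‖w‖ ^ 2) ^ 2 := by
    rw [← norm_sub_sq_real]; ring
  rw [hμ.integral_inner_pow_four he (v + w), hμ.integral_inner_pow_four he (v - w),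
    hμ.integral_inner_pow_four he v, hμ.integral_inner_pow_four he w, hsum, hdiff] at hpolar
  linear_combination hpolar / 12

section ComplexSphere

variable {ι : Type*} [Fintype ι]

theorem sum_norm_sq (φ : sphere (0 : EuclideanSpace ℂ ι) 1) : ∑ a, ‖φ.1 a‖ ^ 2 = 1 := by
  rw [← EuclideanSpace.norm_sq_eq, norm_eq_of_mem_sphere, one_pow]

variable [DecidableEq ι] {μ : Measure (sphere (0 : EuclideanSpace ℂ ι) 1)}

theorem IsIsometryInvariant.exists_integral_norm_sq_mul_norm_sq [IsFiniteMeasure μ]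
    (hμ : IsIsometryInvariant μ) : ∃ m : ℝ, ∀ a b : ι,
      ∫ φ, ‖φ.1 a‖ ^ 2 * ‖φ.1 b‖ ^ 2 ∂μ = m * (1 + if a = b then 1 else 0) := by
  cases isEmpty_or_nonempty ι
  · exact ⟨0, isEmptyElim⟩
  obtain ⟨i₀⟩ := ‹Nonempty ι›
  let e (a : ι) (z : ℂ) : EuclideanSpace ℂ ι := EuclideanSpace.single a z
  have hinner (a : ι) (z : ℂ) (φ : EuclideanSpace ℂ ι) : ⟪e a z, φ⟫ = ⟪z, φ a⟫ := by
    rw [PiLp.inner_apply, Finset.sum_eq_single a (fun c _ hc => by simp [e, hc]) (by simp)]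
    simp [e]
  have hnorm (a : ι) (φ : EuclideanSpace ℂ ι) :
      ‖φ a‖ ^ 2 = ⟪e a 1, φ⟫ ^ 2 + ⟪e a Complex.I, φ⟫ ^ 2 := by
    simp only [hinner, Complex.sq_norm, Complex.normSq_apply]
    simp [sq]
  have hint {f : sphere (0 : EuclideanSpace ℂ ι) 1 → ℝ} (hf : Continuous f) : Integrable f μ :=
    integrable_of_continuous hf
  have hi₀ : ‖e i₀ 1‖ = 1 := by simp [e]
  refine ⟨4 / 3 * ∫ φ, ⟪e i₀ 1, φ.1⟫ ^ 4 ∂μ, fun a b => ?_⟩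
  simp only [hnorm, add_mul, mul_add]
  rw [integral_add (hint (by fun_prop)) (hint (by fun_prop)),
    integral_add (hint (by fun_prop)) (hint (by fun_prop)),
    integral_add (hint (by fun_prop)) (hint (by fun_prop))]
  rw [hμ.integral_inner_sq_mul_inner_sq hi₀, hμ.integral_inner_sq_mul_inner_sq hi₀,
    hμ.integral_inner_sq_mul_inner_sq hi₀, hμ.integral_inner_sq_mul_inner_sq hi₀]
  simp only [hinner]
  split_ifs with hab <;> simp [e, hab] <;> ring

theorem IsIsometryInvariant.integral_norm_sq_mul_norm_sq [IsProbabilityMeasure μ]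
    (hμ : IsIsometryInvariant μ) (a b : ι) : ∫ φ, ‖φ.1 a‖ ^ 2 * ‖φ.1 b‖ ^ 2 ∂μ =
      (1 + if a = b then 1 else 0) / (Fintype.card ι * (Fintype.card ι + 1)) := by
  obtain ⟨m, hm⟩ := hμ.exists_integral_norm_sq_mul_norm_sq
  have hint (a b : ι) : Integrable (fun φ => ‖φ.1 a‖ ^ 2 * ‖φ.1 b‖ ^ 2) μ :=
    integrable_of_continuous (by fun_prop)
  have hsum : ∑ a, ∑ b, ∫ φ, ‖φ.1 a‖ ^ 2 * ‖φ.1 b‖ ^ 2 ∂μ = 1 := by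
    simp_rw [← integral_finsetSum _ fun b _ => hint _ b]
    rw [← integral_finsetSum _ fun a _ => integrable_finsetSum _ fun b _ => hint a b]
    simp [← Finset.mul_sum, sum_norm_sq]
  simp only [hm, ← Finset.mul_sum, Finset.sum_add_distrib, Finset.sum_const, Finset.sum_ite_eq,
    Finset.mem_univ, if_true, Finset.card_univ, nsmul_eq_mul, mul_one] at hsum
  have : Nonempty ι := ⟨a⟩
  rw [hm, eq_div_iff (by positivity)]
  linear_combination (1 + if a = b then (1 : ℝ) else 0) * hsum

end ComplexSphere

end SphereInvariance

section Permutations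

/-- The indicator matrix of the pairs `(x, y)` of `k`-tuples such that `x` satisfies `D` and `y` is
a rearrangement of `x`. -/
def rearrangementMatrix {k : ℕ} {α : Type*} (D : (Fin k → α) → Prop) :
    Matrix (Fin k → α) (Fin k → α) ℂ :=
  open Classical in Matrix.of fun x y => if D x ∧ ∃ σ : Equiv.Perm (Fin k), y = x ∘ σ then 1 else 0

/-- Block-diagonal with all-ones blocks: pulled back from a diagonal matrix on the orbits. -/
theorem posSemidef_rearrangementMatrix {k : ℕ} {α : Type*} {D : (Fin k → α) → Prop}
    (hD : ∀ x, ∀ σ : Equiv.Perm (Fin k), D (x ∘ σ) ↔ D x) :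
    (rearrangementMatrix D).PosSemidef := by
  classical
  let orbits : Setoid (Fin k → α) :=
    { r := fun x y => ∃ σ : Equiv.Perm (Fin k), y = x ∘ σ
      iseqv :=
        { refl := fun x => ⟨1, rfl⟩
          symm := fun ⟨σ, h⟩ => ⟨σ⁻¹, by rw [h]; ext; simp⟩
          trans := fun ⟨σ, h⟩ ⟨τ, h'⟩ => ⟨σ * τ, by rw [h', h]; rfl⟩ } }
  let orbitD : Quotient orbits → Prop :=
    Quotient.lift D fun x y ⟨σ, h⟩ => propext (by rw [h, hD])
  have hdiag : (Matrix.diagonal fun o => if orbitD o then (1 : ℂ) else 0).PosSemidef :=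
    Matrix.PosSemidef.diagonal fun o => by positivity
  convert hdiag.submatrix (Quotient.mk orbits) using 1
  ext x y
  have horbit : (⟦x⟧ : Quotient orbits) = ⟦y⟧ ↔ ∃ σ : Equiv.Perm (Fin k), y = x ∘ σ := Quotient.eq
  by_cases hx : D x <;> by_cases hxy : ∃ σ : Equiv.Perm (Fin k), y = x ∘ σ <;>
    simp [hx, rearrangementMatrix, Matrix.diagonal_apply, horbit, hxy, orbitD]

theorem exists_perm_of_card_fiber_eq {ι α : Type*} [Fintype ι] [DecidableEq α] {x y : ι → α}
    (h : ∀ a, Fintype.card {i // x i = a} = Fintype.card {i // y i = a}) :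
    ∃ σ : Equiv.Perm ι, y = x ∘ σ :=
  ⟨Equiv.ofFiberEquiv fun a => Fintype.equivOfCardEq (h a).symm,
    funext fun j => (Equiv.ofFiberEquiv_map _ j).symm⟩

end Permutations

theorem posSemidef_integral {ι X : Type*} [Finite ι] [MeasurableSpace X] {μ : Measure X}
    {M : X → Matrix ι ι ℂ} (hM : ∀ ω, (M ω).PosSemidef)
    (hint : ∀ i j, Integrable (fun ω => M ω i j) μ) :
    (Matrix.of fun i j => ∫ ω, M ω i j ∂μ).PosSemidef := by
  have := Fintype.ofFinite ι
  refine Matrix.PosSemidef.of_dotProduct_mulVec_nonneg ?_ fun v => ?_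
  · ext i j
    rw [Matrix.conjTranspose_apply, Matrix.of_apply, Matrix.of_apply]
    exact integral_conj.symm.trans (integral_congr_ae (.of_forall fun ω => (hM ω).1.apply i j))
  · have hquad : star v ⬝ᵥ (Matrix.of fun i j => ∫ ω, M ω i j ∂μ) *ᵥ v =
        ∫ ω, star v ⬝ᵥ M ω *ᵥ v ∂μ := by
      simp only [dotProduct, Matrix.mulVec, Matrix.of_apply]
      rw [integral_finsetSum _ fun i _ => (integrable_finsetSum _ fun j _ =>
        (hint i j).mul_const _).const_mul _]
      simp_rw [integral_const_mul, integral_finsetSum _ fun j _ => (hint _ j).mul_const _,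
        integral_mul_const]
    rw [hquad]
    exact integral_nonneg fun ω => (hM ω).dotProduct_mulVec_nonneg v

section Moments

variable {Q : Type} [Fintype Q] [DecidableEq Q] {k : ℕ}

theorem moment_apply (S : Measure (PureState Q)) (x y : Fin k → Bits Q) :
    moment k S x y = ∫ φ, ∏ j, φ.1 (x j) * star (φ.1 (y j)) ∂S := rfl

theorem posSemidef_moment (S : Measure (PureState Q)) [IsFiniteMeasure S] :
    (moment k S).PosSemidef := by
  refine posSemidef_integral (fun φ => ?_) fun x y => integrable_of_continuous (by
    simp only [tensorPower, projector, Matrix.of_apply]; fun_prop)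
  convert Matrix.posSemidef_vecMulVec_self_star fun x : Fin k → Bits Q => ∏ j, φ.1 (x j) using 1
  ext x y
  simp [tensorPower, projector, Matrix.vecMulVec_apply, Finset.prod_mul_distrib]

theorem moment_apply_self_re (S : Measure (PureState Q)) (x : Fin k → Bits Q) :
    (moment k S x x).re = ∫ φ, ∏ j, ‖φ.1 (x j)‖ ^ 2 ∂S := by
  rw [moment_apply, ← Complex.ofReal_re (∫ φ, _ ∂S), ← integral_complex_ofReal]
  congr 2 with φ
  push_cast
  exact Finset.prod_congr rfl fun j _ => Complex.mul_conj' _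

theorem trace_moment (S : Measure (PureState Q)) [IsProbabilityMeasure S] :
    (moment k S).trace = 1 := by
  simp only [Matrix.trace, Matrix.diag_apply, moment_apply]
  rw [← integral_finsetSum _ fun x _ => integrable_of_continuous (by fun_prop)]
  have hφ (φ : PureState Q) : ∑ x : Fin k → Bits Q, ∏ j, φ.1 (x j) * star (φ.1 (x j)) = 1 := by
    rw [← Fintype.prod_sum fun (_ : Fin k) z => φ.1 z * star (φ.1 z)]
    simp only [Complex.star_def, Complex.mul_conj', ← Complex.ofReal_pow, ← Complex.ofReal_sum,
      sum_norm_sq, Complex.ofReal_one, Finset.prod_const_one]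
  simp only [hφ, integral_const, probReal_univ, one_smul]

theorem moment_comp_perm (S : Measure (PureState Q)) (x y : Fin k → Bits Q)
    (σ : Equiv.Perm (Fin k)) : moment k S x (y ∘ σ) = moment k S x y := by
  simp only [moment_apply, Finset.prod_mul_distrib, Function.comp_apply]
  congr 1 with φ
  rw [Equiv.prod_comp σ fun j => star (φ.1 (y j))]

theorem isIsometryInvariant_haarEnsemble : IsIsometryInvariant (haarEnsemble Q) := fun U =>
  (measurePreserving_sphereHomeomorph U.measurePreserving).smul_measure _

/-- Multiplication of the coordinate `a` by the phase `c`. -/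
def coordinatePhase {ι : Type*} [Fintype ι] [DecidableEq ι] (a : ι) (c : Circle) :
    EuclideanSpace ℂ ι ≃ₗᵢ[ℝ] EuclideanSpace ℂ ι :=
  LinearIsometryEquiv.piLpCongrRight 2 fun z => if z = a then rotation c else .refl ℝ ℂ

theorem coordinatePhase_apply {ι : Type*} [Fintype ι] [DecidableEq ι] (a : ι) (c : Circle)
    (φ : EuclideanSpace ℂ ι) (z : ι) :
    coordinatePhase a c φ z = (if z = a then (c : ℂ) else 1) * φ z := by
  simp only [coordinatePhase, LinearIsometryEquiv.piLpCongrRight_apply]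
  split_ifs <;> simp

theorem exists_perm_of_moment_haar_ne_zero {x y : Fin k → Bits Q}
    (h : moment k (haarEnsemble Q) x y ≠ 0) : ∃ σ : Equiv.Perm (Fin k), y = x ∘ σ := by
  refine exists_perm_of_card_fiber_eq fun a => ?_
  rw [Fintype.card_subtype, Fintype.card_subtype]
  set m := (Finset.univ.filter fun j => x j = a).card with hm
  set n := (Finset.univ.filter fun j => y j = a).card with hn
  have hphase (c : Circle) : (c : ℂ) ^ m * star (c : ℂ) ^ n = 1 := by
    have hinv := isIsometryInvariant_haarEnsemble.integral_comp (coordinatePhase a c)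
      fun φ => ∏ j, φ (x j) * star (φ (y j))
    have hprod (φ : PureState Q) : ∏ j, coordinatePhase a c φ.1 (x j) *
        star (coordinatePhase a c φ.1 (y j)) =
          ((c : ℂ) ^ m * star (c : ℂ) ^ n) * ∏ j, φ.1 (x j) * star (φ.1 (y j)) := by
      simp only [coordinatePhase_apply, star_mul', Finset.prod_mul_distrib, apply_ite star,
        star_one, Finset.prod_ite, Finset.prod_const, ← hm, ← hn]
      ring
    simp only [hprod, integral_const_mul] at hinv
    exact (mul_eq_right₀ h).1 hinv
  have hprim := Complex.isPrimitiveRoot_exp (k + 1) (by omega)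
  obtain ⟨c, hc⟩ : ∃ c : Circle, IsPrimitiveRoot (c : ℂ) (k + 1) :=
    ⟨⟨_, mem_sphere_zero_iff_norm.2 (hprim.norm'_eq_one (by omega))⟩, hprim⟩
  have hcard (p : Fin k → Prop) [DecidablePred p] :
      (Finset.univ.filter p).card < k + 1 :=
    Nat.lt_succ_of_le ((Finset.card_le_univ _).trans_eq (Fintype.card_fin k))
  refine hc.pow_inj (hcard _) (hcard _) ?_
  have hcc : star (c : ℂ) * c = 1 :=
    (Complex.conj_mul' _).trans (by rw [Circle.norm_coe]; simp)
  have := congrArg (· * (c : ℂ) ^ n) (hphase c)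
  rwa [mul_assoc, ← mul_pow, hcc, one_pow, mul_one, one_mul] at this

theorem moment_haar_self_eq_of_injective {x y : Fin k → Bits Q} (hx : Function.Injective x)
    (hy : Function.Injective y) :
    moment k (haarEnsemble Q) x x = moment k (haarEnsemble Q) y y := by
  obtain ⟨e, he⟩ := Equiv.Perm.exists_extending_pair x y hx hy
  have hinv := isIsometryInvariant_haarEnsemble.integral_comp
    (LinearIsometryEquiv.piLpCongrLeft 2 ℝ ℂ e.symm) fun φ => ∏ j, φ (x j) * star (φ (x j))
  simpa [LinearIsometryEquiv.piLpCongrLeft_apply, he, moment_apply] using hinv.symm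

theorem exists_moment_haar_eq_rearrangementMatrix (Q : Type) [Fintype Q] [DecidableEq Q] (k : ℕ) :
    ∃ p : ℝ, ∀ x y : Fin k → Bits Q, Function.Injective x →
      moment k (haarEnsemble Q) x y = p * rearrangementMatrix Function.Injective x y := by
  obtain ⟨p, hp⟩ : ∃ p : ℝ, ∀ x : Fin k → Bits Q, Function.Injective x →
      moment k (haarEnsemble Q) x x = p := by
    by_cases hx : ∃ x₀ : Fin k → Bits Q, Function.Injective x₀
    · obtain ⟨x₀, hx₀⟩ := hx
      refine ⟨(moment k (haarEnsemble Q) x₀ x₀).re, fun x hx => ?_⟩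
      rw [moment_haar_self_eq_of_injective hx hx₀]
      exact ((posSemidef_moment _).1.coe_re_apply_self x₀).symm
    · exact ⟨0, fun x h => absurd ⟨x, h⟩ hx⟩
  refine ⟨p, fun x y hx => ?_⟩
  by_cases hσ : ∃ σ : Equiv.Perm (Fin k), y = x ∘ σ
  · obtain ⟨σ, rfl⟩ := hσ
    rw [moment_comp_perm, hp x hx, rearrangementMatrix, Matrix.of_apply, if_pos ⟨hx, σ, rfl⟩,
      mul_one]
  · simp only [rearrangementMatrix, Matrix.of_apply, hσ, and_false, if_false, mul_zero]
    exact not_imp_comm.1 exists_perm_of_moment_haar_ne_zero hσ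

end Moments

section Collisions

section Tuples

variable {ι α : Type*} [Fintype ι] [DecidableEq ι] [Fintype α]

theorem sum_prod_of_pair_eq [DecidableEq α] {q : α → ℝ} (hq : ∑ a, q a = 1) {i j : ι} (hij : i ≠ j)
    (a b : α) : ∑ x : ι → α with x i = a ∧ x j = b, ∏ l, q (x l) = q a * q b := by
  let t (l : ι) : Finset α := if l = i then {a} else if l = j then {b} else Finset.univ
  have hti : t i = {a} := if_pos rfl
  have htj : t j = {b} := (if_neg hij.symm).trans (if_pos rfl)
  have ht {l : ι} (hi : l ≠ i) (hj : l ≠ j) : t l = Finset.univ := by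
    simp only [t, hi, hj, if_false]
  have hpi : (Finset.univ.filter fun x : ι → α => x i = a ∧ x j = b) = Fintype.piFinset t := by
    ext x
    simp only [Finset.mem_filter, Finset.mem_univ, true_and, Fintype.mem_piFinset]
    refine ⟨fun ⟨hi, hj⟩ l => ?_, fun h => ⟨by simpa [hti] using h i, by simpa [htj] using h j⟩⟩
    simp only [t]
    split_ifs <;> simp_all
  rw [hpi, ← Finset.prod_univ_sum, ← Finset.prod_subset (Finset.subset_univ {i, j}),
    Finset.prod_pair hij, hti, htj, Finset.sum_singleton, Finset.sum_singleton]
  intro l _ hl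
  simp only [Finset.mem_insert, Finset.mem_singleton, not_or] at hl
  rw [ht hl.1 hl.2, hq]

theorem sum_prod_of_related (r : α → α → Prop) [DecidableRel r] {q : α → ℝ}
    (hq : ∑ a, q a = 1) {i j : ι} (hij : i ≠ j) :
    ∑ x : ι → α with r (x i) (x j), ∏ l, q (x l) = ∑ p : α × α with r p.1 p.2, q p.1 * q p.2 := by
  classical
  rw [← Finset.sum_fiberwise_of_maps_to
    (t := Finset.univ.filter fun p : α × α => r p.1 p.2) (g := fun x => (x i, x j)) (by simp)]
  refine Finset.sum_congr rfl fun p hp => ?_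
  rw [← sum_prod_of_pair_eq hq hij, Finset.filter_filter]
  refine Finset.sum_congr (Finset.filter_congr fun x _ => ?_) fun _ _ => rfl
  rw [Prod.ext_iff]
  refine and_iff_right_of_imp fun ⟨hi, hj⟩ => ?_
  simpa only [← hi, ← hj] using (Finset.mem_filter.1 hp).2

theorem sum_not_injective_le {β : Type*} [DecidableEq β] {g : α → β} {m : (ι → α) → ℝ}
    (hm : 0 ≤ m) {δ : ℝ} (hδ₀ : 0 ≤ δ)
    (hδ : ∀ i j, i ≠ j → ∑ x with g (x i) = g (x j), m x ≤ δ) :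
    ∑ x with ¬Function.Injective (fun i => g (x i)), m x ≤ Fintype.card ι ^ 2 * δ := by
  calc ∑ x with ¬Function.Injective (fun i => g (x i)), m x
      ≤ ∑ x, ∑ p ∈ Finset.univ.offDiag, if g (x p.1) = g (x p.2) then m x else 0 := by
        rw [Finset.sum_filter]
        refine Finset.sum_le_sum fun x _ => ?_
        have hterm (p : ι × ι) : 0 ≤ if g (x p.1) = g (x p.2) then m x else 0 := by
          split_ifs
          exacts [hm x, le_rfl]
        split_ifs with hx
        · exact Finset.sum_nonneg fun p _ => hterm p
        · obtain ⟨i, j, heq, hij⟩ := Function.not_injective_iff.1 hx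
          refine le_of_eq_of_le (if_pos heq).symm
            (Finset.single_le_sum (fun p _ => hterm p) (a := (i, j)) ?_)
          simpa using hij
    _ = ∑ p ∈ Finset.univ.offDiag, ∑ x with g (x p.1) = g (x p.2), m x := by
        rw [Finset.sum_comm]
        simp_rw [Finset.sum_filter]
    _ ≤ (Finset.univ : Finset ι).offDiag.card • δ :=
        Finset.sum_le_card_nsmul _ _ _ fun p hp => hδ _ _ (Finset.mem_offDiag.1 hp).2.2
    _ ≤ Fintype.card ι ^ 2 * δ := by
        rw [nsmul_eq_mul, Finset.offDiag_card, Finset.card_univ, sq]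
        gcongr
        exact_mod_cast Nat.sub_le _ _

end Tuples

theorem card_comp_eq_mul {Q R : Type*} [Fintype Q] [DecidableEq Q] [Fintype R] {g : R → Q}
    (hg : Function.Injective g) (w : Q → Bool) :
    (Finset.univ.filter fun u : Q → Bool => w ∘ g = u ∘ g).card * 2 ^ Fintype.card R =
      2 ^ Fintype.card Q := by
  classical
  let t (q : Q) : Finset Bool := if q ∈ Finset.univ.image g then {w q} else Finset.univ
  have hfibre : (Finset.univ.filter fun u : Q → Bool => w ∘ g = u ∘ g) = Fintype.piFinset t := by
    ext u
    simp only [Finset.mem_filter, Finset.mem_univ, true_and, Fintype.mem_piFinset, funext_iff,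
      Function.comp_apply]
    refine ⟨fun h q => ?_, fun h a => ?_⟩
    · by_cases hq : q ∈ Finset.univ.image g
      · obtain ⟨a, -, rfl⟩ := Finset.mem_image.1 hq
        simp [t, h a]
      · simp only [t, hq, if_false, Finset.mem_univ]
    · simpa [t, eq_comm] using h (g a)
  have hrange : 2 ^ Fintype.card R = ∏ q, if q ∈ Finset.univ.image g then 2 else 1 := by
    rw [Finset.prod_ite_mem, Finset.univ_inter, Finset.prod_const,
      Finset.card_image_of_injective _ hg, Finset.card_univ]
  rw [hfibre, Fintype.card_piFinset, hrange, ← Finset.prod_mul_distrib, ← Finset.card_univ,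
    ← Finset.prod_const]
  refine Finset.prod_congr rfl fun q _ => ?_
  by_cases hq : q ∈ Finset.univ.image g <;> simp only [t, hq, if_true, if_false] <;> simp

section HaarCollisions

variable {Q : Type} [Fintype Q] [DecidableEq Q] {k : ℕ} {i j : Fin k}

theorem sum_related_moment_haar_eq (r : Bits Q → Bits Q → Prop) [DecidableRel r] (hij : i ≠ j) :
    ∑ x with r (x i) (x j), (moment k (haarEnsemble Q) x x).re =
      ∑ p : Bits Q × Bits Q with r p.1 p.2, (1 + if p.1 = p.2 then 1 else 0) /
        ((2 : ℝ) ^ Fintype.card Q * (2 ^ Fintype.card Q + 1)) := by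
  have hint {f : PureState Q → ℝ} (hf : Continuous f) : Integrable f (haarEnsemble Q) :=
    integrable_of_continuous hf
  simp_rw [moment_apply_self_re]
  rw [← integral_finsetSum _ fun x _ => hint (by fun_prop)]
  simp_rw [fun φ : PureState Q => sum_prod_of_related r (sum_norm_sq φ) hij]
  rw [integral_finsetSum _ fun p _ => hint (by fun_prop)]
  simp_rw [isIsometryInvariant_haarEnsemble.integral_norm_sq_mul_norm_sq]
  simp

theorem sum_collision_moment_haar_le {R : Type*} [Fintype R] {g : R → Q}
    (hg : Function.Injective g) (hij : i ≠ j) :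
    ∑ x with x i ∘ g = x j ∘ g, (moment k (haarEnsemble Q) x x).re ≤ 2 / 2 ^ Fintype.card R := by
  set d : ℝ := 2 ^ Fintype.card Q
  set X : ℝ := 2 ^ Fintype.card R
  have hXd : X ≤ d := pow_le_pow_right₀ one_le_two (Fintype.card_le_of_injective g hg)
  have hX : 0 < X := by positivity
  have hd : 0 < d := by positivity
  have hdim : (Fintype.card (Bits Q) : ℝ) = d := by simp [d]
  have hcard (u : Bits Q) :
      ((Finset.univ.filter fun v : Bits Q => u ∘ g = v ∘ g).card : ℝ) = d / X := by
    rw [eq_div_iff hX.ne']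
    simp only [d, X]
    exact_mod_cast card_comp_eq_mul hg u
  have hrow (u : Bits Q) :
      ∑ v : Bits Q with u ∘ g = v ∘ g, (1 + if u = v then 1 else 0) / (d * (d + 1)) =
        (d / X + 1) / (d * (d + 1)) := by
    rw [← Finset.sum_div, Finset.sum_add_distrib, Finset.sum_const, nsmul_eq_mul, mul_one,
      hcard, Finset.sum_ite_eq, if_pos (by simp)]
  rw [sum_related_moment_haar_eq (fun u v => u ∘ g = v ∘ g) hij, Finset.sum_filter,
    Fintype.sum_prod_type,
    Finset.sum_congr rfl fun u _ => (Finset.sum_filter _ _).symm.trans (hrow u), Finset.sum_const,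
    Finset.card_univ, nsmul_eq_mul, hdim, ← mul_div_assoc, mul_div_mul_left _ _ hd.ne',
    div_le_div_iff₀ (by positivity) hX, add_mul, div_mul_cancel₀ _ hX.ne']
  linarith

end HaarCollisions

end Collisions

section Signs

variable {X : Type}

theorem IsWiseIndependent.integral_comp {t : ℕ} {ν : Measure (X → Bool)} [IsProbabilityMeasure ν]
    (hν : IsWiseIndependent t ν) {x : Fin t → X} (hx : Function.Injective x)
    (h : (Fin t → Bool) → ℂ) : ∫ f, h (f ∘ x) ∂ν = ((2 : ℝ) ^ t)⁻¹ • ∑ y, h y := by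
  have hmeas : Measurable fun f : X → Bool => f ∘ x := by fun_prop
  have hlaw (y : Fin t → Bool) : (ν.map fun f => f ∘ x).real {y} = ((2 : ℝ) ^ t)⁻¹ := by
    rw [← hν x hx y, map_measureReal_apply hmeas (measurableSet_singleton y)]
    congr 1 with f
    exact funext_iff
  have := Measure.isProbabilityMeasure_map hmeas.aemeasurable (μ := ν)
  rw [← integral_map (f := h) hmeas.aemeasurable (measurable_of_countable h).aestronglyMeasurable,
    integral_fintype (.of_finite)]
  simp_rw [hlaw, ← Finset.smul_sum]

theorem sum_prod_sign_eq_zero {ι κ : Type*} [Fintype ι] [Fintype κ] [DecidableEq κ] (w : ι → κ)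
    {s : κ} (hs : Odd (Finset.univ.filter fun j => w j = s).card) :
    ∑ y : κ → Bool, ∏ j, (-1 : ℂ) ^ (y (w j)).toNat = 0 := by
  let flip (y : κ → Bool) : κ → Bool := Function.update y s !y s
  have hflip : Function.Involutive flip := fun y => by simp [flip]
  have hsign (y : κ → Bool) (i : κ) :
      (-1 : ℂ) ^ (flip y i).toNat = (if i = s then -1 else 1) * (-1) ^ (y i).toNat := by
    by_cases hi : i = s
    · subst hi
      cases h : y i <;> simp [flip, h]
    · simp [flip, hi]
  have hneg (y : κ → Bool) : ∏ j, (-1 : ℂ) ^ (flip y (w j)).toNat =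
      -∏ j, (-1 : ℂ) ^ (y (w j)).toNat := by
    simp_rw [hsign, Finset.prod_mul_distrib, Finset.prod_ite, Finset.prod_const, hs.neg_one_pow]
    simp
  rw [← self_eq_neg, ← Finset.sum_neg_distrib]
  simp_rw [← hneg]
  exact (Equiv.sum_comp hflip.toPerm fun y : κ → Bool => ∏ j, (-1 : ℂ) ^ (y (w j)).toNat).symm

theorem IsWiseIndependent.integral_prod_sign_eq_zero [Finite X] {t : ℕ} {ν : Measure (X → Bool)}
    [IsProbabilityMeasure ν] (hν : IsWiseIndependent t ν) (ht : t ≤ Nat.card X)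
    {ι : Type*} [Fintype ι] (hι : Fintype.card ι ≤ t) [DecidableEq X] (w : ι → X) {s : X}
    (hs : Odd (Finset.univ.filter fun j => w j = s).card) :
    ∫ f, ∏ j, (-1 : ℂ) ^ (f (w j)).toNat ∂ν = 0 := by
  have := Fintype.ofFinite X
  obtain ⟨T, hwT, hT⟩ := Finset.exists_superset_card_eq (s := Finset.univ.image w)
    (Finset.card_image_le.trans hι) (by rwa [← Nat.card_eq_fintype_card])
  have hmem (j : ι) : w j ∈ T := hwT (Finset.mem_image_of_mem w (Finset.mem_univ j))
  let e : T ≃ Fin t := T.equivFinOfCardEq hT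
  let index (j : ι) : Fin t := e ⟨w j, hmem j⟩
  obtain ⟨j₀, hj₀⟩ : ∃ j, w j = s := by
    simpa [Finset.Nonempty] using Finset.card_pos.1 hs.pos
  have hfibre (j : ι) : index j = index j₀ ↔ w j = s := by simp [index, hj₀]
  have hint := hν.integral_comp (Subtype.val_injective.comp e.symm.injective)
    fun y => ∏ j, (-1 : ℂ) ^ (y (index j)).toNat
  rw [sum_prod_sign_eq_zero index (s := index j₀) (by simpa only [hfibre] using hs),
    smul_zero] at hint
  simpa [index] using hint

/-- The eigenvalue at `u` of the tensor power `F_f^{⊗k}` of the phase operator. -/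
def phaseEigenvalue {k : ℕ} (f : X → Bool) (u : Fin k → X) : ℂ := ∏ j, (-1) ^ (f (u j)).toNat

/-- The average of conjugation by `F_f^{⊗k}` multiplies the `(u, v)` entry of a matrix by the
`(u, v)` entry of this one. -/
def phaseMoment (k : ℕ) (ν : Measure (X → Bool)) : Matrix (Fin k → X) (Fin k → X) ℂ :=
  Matrix.of fun u v => ∫ f, phaseEigenvalue f u * star (phaseEigenvalue f v) ∂ν

theorem phaseEigenvalue_mul_star {k : ℕ} (f : X → Bool) (u v : Fin k → X) :
    phaseEigenvalue f u * star (phaseEigenvalue f v) =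
      ∏ j, (-1 : ℂ) ^ (f (Sum.elim u v j)).toNat := by
  simp [phaseEigenvalue]

theorem posSemidef_phaseMoment [Finite X] (k : ℕ) (ν : Measure (X → Bool)) [IsFiniteMeasure ν] :
    (phaseMoment k ν).PosSemidef :=
  posSemidef_integral (fun f => Matrix.posSemidef_vecMulVec_self_star (phaseEigenvalue f))
    fun _ _ => .of_finite

theorem phaseMoment_comp_perm {k : ℕ} (ν : Measure (X → Bool)) [IsProbabilityMeasure ν]
    (u : Fin k → X) (σ : Equiv.Perm (Fin k)) : phaseMoment k ν u (u ∘ σ) = 1 := by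
  have hone (f : X → Bool) : phaseEigenvalue f u * star (phaseEigenvalue f (u ∘ σ)) = 1 := by
    have hperm : phaseEigenvalue f (u ∘ σ) = phaseEigenvalue f u :=
      Equiv.prod_comp σ fun j => (-1 : ℂ) ^ (f (u j)).toNat
    rw [hperm, Complex.star_def, Complex.mul_conj']
    simp [phaseEigenvalue]
  simp only [phaseMoment, Matrix.of_apply, hone, integral_const, probReal_univ, one_smul]

theorem IsWiseIndependent.exists_perm_of_phaseMoment_ne_zero [Finite X] {k : ℕ}
    {ν : Measure (X → Bool)} [IsProbabilityMeasure ν] (hν : IsWiseIndependent (2 * k) ν)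
    (hk : 2 * k ≤ Nat.card X) {u v : Fin k → X} (hu : Function.Injective u)
    (h : phaseMoment k ν u v ≠ 0) : ∃ σ : Equiv.Perm (Fin k), v = u ∘ σ := by
  classical
  have hmem (j : Fin k) : ∃ i, v i = u j := by
    by_contra! hj
    have hfibre : (Finset.univ.filter fun i => Sum.elim u v i = u j) = {.inl j} := by
      ext (i | i) <;> simp [hj, hu.eq_iff]
    refine h ?_
    rw [phaseMoment, Matrix.of_apply]
    simp_rw [phaseEigenvalue_mul_star]
    exact hν.integral_prod_sign_eq_zero hk (by simp [two_mul]) _ (s := u j) (by simp [hfibre])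
  choose τ hτ using hmem
  have hinj : Function.Injective τ := fun i j hij => hu (by rw [← hτ, ← hτ, hij])
  let σ : Equiv.Perm (Fin k) := .ofBijective τ (Finite.injective_iff_bijective.1 hinj)
  exact ⟨σ⁻¹, funext fun j =>
    (congrArg v (σ.apply_symm_apply j)).symm.trans (hτ (σ⁻¹ j))⟩

end Signs

section Glue

open scoped Kronecker

variable {A B : Type} {k : ℕ}

/-- The identification of the `k`-tuples of bitstrings on `A ⊔ B` with the pairs of `k`-tuples of
bitstrings on `A` and on `B`. -/
def splitTuple : (Fin k → Bits (A ⊕ B)) ≃ (Fin k → Bits A) × (Fin k → Bits B) :=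
  ((Equiv.refl (Fin k)).arrowCongr (Equiv.sumArrowEquivProdArrow A B Bool)).trans
    (Equiv.arrowProdEquivProdArrow (Fin k) (fun _ => Bits A) fun _ => Bits B)

/-- The effect of the gluing on `k`-th moments: the matrix `M ⊗ N` on `k` copies of `A ⊔ B`,
conjugated by `(F_f ⊗ 1)^{⊗k}` and averaged over `f ∼ ν`. -/
def glueMatrix (ΞA : Finset A) (ΞB : Finset B) (ν : Measure (Bits (ΞA ⊕ ΞB) → Bool))
    (M : Matrix (Fin k → Bits A) (Fin k → Bits A) ℂ)
    (N : Matrix (Fin k → Bits B) (Fin k → Bits B) ℂ) :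
    Matrix (Fin k → Bits (A ⊕ B)) (Fin k → Bits (A ⊕ B)) ℂ :=
  (M ⊗ₖ N).submatrix splitTuple splitTuple ⊙
    (phaseMoment k ν).submatrix (restrictBits ΞA ΞB ∘ ·) (restrictBits ΞA ΞB ∘ ·)

variable {ΞA : Finset A} {ΞB : Finset B} {ν : Measure (Bits (ΞA ⊕ ΞB) → Bool)}
  {M : Matrix (Fin k → Bits A) (Fin k → Bits A) ℂ} {N : Matrix (Fin k → Bits B) (Fin k → Bits B) ℂ}

theorem glueMatrix_apply (x y : Fin k → Bits (A ⊕ B)) :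
    glueMatrix ΞA ΞB ν M N x y = M (splitTuple x).1 (splitTuple y).1 *
      N (splitTuple x).2 (splitTuple y).2 *
        phaseMoment k ν (restrictBits ΞA ΞB ∘ x) (restrictBits ΞA ΞB ∘ y) := rfl

theorem glueMatrix_sub_left (M' : Matrix (Fin k → Bits A) (Fin k → Bits A) ℂ) :
    glueMatrix ΞA ΞB ν (M - M') N = glueMatrix ΞA ΞB ν M N - glueMatrix ΞA ΞB ν M' N := by
  ext x y
  simp only [glueMatrix_apply, Matrix.sub_apply, sub_mul]

theorem glueMatrix_sub_right (N' : Matrix (Fin k → Bits B) (Fin k → Bits B) ℂ) :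
    glueMatrix ΞA ΞB ν M (N - N') = glueMatrix ΞA ΞB ν M N - glueMatrix ΞA ΞB ν M N' := by
  ext x y
  simp only [glueMatrix_apply, Matrix.sub_apply, mul_sub, sub_mul]

theorem posSemidef_glueMatrix [Finite A] [Finite B] [IsFiniteMeasure ν] (hM : M.PosSemidef)
    (hN : N.PosSemidef) : (glueMatrix ΞA ΞB ν M N).PosSemidef :=
  ((hM.kronecker hN).submatrix _).hadamard ((posSemidef_phaseMoment k ν).submatrix _)

variable [Fintype A] [DecidableEq A] [Fintype B] [DecidableEq B]

theorem sum_glueMatrix_self [IsProbabilityMeasure ν] (p : (Fin k → Bits A) → Prop)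
    [DecidablePred p] (q : (Fin k → Bits B) → Prop) [DecidablePred q] :
    ∑ x with p (splitTuple x).1 ∧ q (splitTuple x).2, glueMatrix ΞA ΞB ν M N x x =
      (∑ a with p a, M a a) * ∑ b with q b, N b b := by
  have hphase (x : Fin k → Bits (A ⊕ B)) :
      phaseMoment k ν (restrictBits ΞA ΞB ∘ x) (restrictBits ΞA ΞB ∘ x) = 1 :=
    phaseMoment_comp_perm ν _ 1
  simp_rw [glueMatrix_apply, hphase, mul_one]
  rw [Finset.sum_mul_sum, ← Finset.sum_product', ← Finset.filter_product, Finset.univ_product_univ,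
    Finset.sum_filter, Finset.sum_filter]
  exact splitTuple.sum_comp fun ab : (Fin k → Bits A) × (Fin k → Bits B) =>
    if p ab.1 ∧ q ab.2 then M ab.1 ab.1 * N ab.2 ab.2 else 0

theorem trace_glueMatrix [IsProbabilityMeasure ν] :
    (glueMatrix ΞA ΞB ν M N).trace = M.trace * N.trace := by
  simpa [Matrix.trace] using sum_glueMatrix_self (ΞA := ΞA) (ΞB := ΞB) (ν := ν) (M := M) (N := N)
    (fun _ => True) fun _ => True

theorem traceNorm_glueMatrix_le_left [IsProbabilityMeasure ν] (hM : M.IsHermitian)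
    (hN : N.PosSemidef) (hN₁ : N.trace = 1) :
    traceNorm (glueMatrix ΞA ΞB ν M N) ≤ traceNorm M := by
  refine traceNorm_map_le (AddMonoidHom.ofMapSub (fun M => glueMatrix ΞA ΞB ν M N)
    fun _ _ => glueMatrix_sub_left _) (fun P hP => posSemidef_glueMatrix hP hN) (fun P _ => ?_) hM
  simp [trace_glueMatrix, hN₁]

theorem traceNorm_glueMatrix_le_right [IsProbabilityMeasure ν] (hM : M.PosSemidef)
    (hM₁ : M.trace = 1) (hN : N.IsHermitian) :
    traceNorm (glueMatrix ΞA ΞB ν M N) ≤ traceNorm N := by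
  refine traceNorm_map_le (AddMonoidHom.ofMapSub (fun N => glueMatrix ΞA ΞB ν M N)
    fun _ _ => glueMatrix_sub_right _) (fun P hP => posSemidef_glueMatrix hM hP) (fun P _ => ?_) hN
  simp [trace_glueMatrix, hM₁]

theorem traceNorm_glueMatrix_sub_glueMatrix_le [IsProbabilityMeasure ν]
    {M' : Matrix (Fin k → Bits A) (Fin k → Bits A) ℂ}
    {N' : Matrix (Fin k → Bits B) (Fin k → Bits B) ℂ} (hM : M.PosSemidef) (hM' : M'.PosSemidef)
    (hN : N.PosSemidef) (hN' : N'.PosSemidef) (hM'₁ : M'.trace = 1) (hN₁ : N.trace = 1) :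
    traceNorm (glueMatrix ΞA ΞB ν M N - glueMatrix ΞA ΞB ν M' N') ≤
      traceNorm (M - M') + traceNorm (N - N') := by
  have hM'N : (glueMatrix ΞA ΞB ν M' N).IsHermitian := (posSemidef_glueMatrix hM' hN).1
  rw [← sub_add_sub_cancel _ (glueMatrix ΞA ΞB ν M' N)]
  refine (traceNorm_add_le ((posSemidef_glueMatrix hM hN).1.sub hM'N)
    (hM'N.sub (posSemidef_glueMatrix hM' hN').1)).trans (add_le_add ?_ ?_)
  · rw [← glueMatrix_sub_left]
    exact traceNorm_glueMatrix_le_left (hM.1.sub hM'.1) hN hN₁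
  · rw [← glueMatrix_sub_right]
    exact traceNorm_glueMatrix_le_right hM' hM'₁ (hN.1.sub hN'.1)

theorem moment_gluedEnsemble [IsProbabilityMeasure ν] (SA : Measure (PureState A))
    [IsProbabilityMeasure SA] (SB : Measure (PureState B)) [IsProbabilityMeasure SB] :
    moment k (gluedEnsemble ΞA ΞB SA SB ν) =
      glueMatrix ΞA ΞB ν (moment k SA) (moment k SB) := by
  ext x y
  have hcont : Continuous fun φ : PureState (A ⊕ B) => ∏ j, φ.1 (x j) * star (φ.1 (y j)) := by
    fun_prop
  rw [moment_apply, gluedEnsemble, integral_map (measurable_glue ΞA ΞB).aemeasurable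
    hcont.aestronglyMeasurable, glueMatrix_apply, moment_apply, moment_apply, phaseMoment,
    Matrix.of_apply, ← integral_prod_mul, ← integral_prod_mul]
  congr 1 with p
  rw [phaseEigenvalue, phaseEigenvalue, star_prod, ← Finset.prod_mul_distrib,
    ← Finset.prod_mul_distrib, ← Finset.prod_mul_distrib]
  refine Finset.prod_congr rfl fun j _ => ?_
  calc _ = ((-1) ^ (p.2 (restrictBits ΞA ΞB (x j))).toNat *
        (p.1.1.1 (x j ∘ Sum.inl) * p.1.2.1 (x j ∘ Sum.inr))) *
      star ((-1) ^ (p.2 (restrictBits ΞA ΞB (y j))).toNat *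
        (p.1.1.1 (y j ∘ Sum.inl) * p.1.2.1 (y j ∘ Sum.inr))) := rfl
    _ = (p.1.1.1 (x j ∘ Sum.inl) * star (p.1.1.1 (y j ∘ Sum.inl))) *
        (p.1.2.1 (x j ∘ Sum.inr) * star (p.1.2.1 (y j ∘ Sum.inr))) *
      ((-1) ^ (p.2 (restrictBits ΞA ΞB (x j))).toNat *
        star ((-1) ^ (p.2 (restrictBits ΞA ΞB (y j))).toNat)) := by
      simp only [star_mul']
      ring

end Glue

section HaarGlue

variable {A B : Type} {k : ℕ} {ΞA : Finset A} {ΞB : Finset B}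

/-- Tuples of bitstrings on `A ⊔ B` with distinct restrictions to `ΞA` and distinct restrictions to
`ΞB`. -/
def IsLocallyDistinct (ΞA : Finset A) (ΞB : Finset B) (x : Fin k → Bits (A ⊕ B)) : Prop :=
  Function.Injective (fun j => x j ∘ Sum.inl ∘ ((↑) : ΞA → A)) ∧
    Function.Injective (fun j => x j ∘ Sum.inr ∘ ((↑) : ΞB → B))

theorem isLocallyDistinct_comp_perm (x : Fin k → Bits (A ⊕ B)) (σ : Equiv.Perm (Fin k)) :
    IsLocallyDistinct ΞA ΞB (x ∘ σ) ↔ IsLocallyDistinct ΞA ΞB x :=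
  and_congr
    (EquivLike.injective_comp σ fun j => x j ∘ Sum.inl ∘ ((↑) : ΞA → A))
    (EquivLike.injective_comp σ fun j => x j ∘ Sum.inr ∘ ((↑) : ΞB → B))

namespace IsLocallyDistinct

variable {x : Fin k → Bits (A ⊕ B)}

theorem injective (hx : IsLocallyDistinct ΞA ΞB x) : Function.Injective x :=
  fun _ _ hij => hx.1 (by simp only [hij])

theorem injective_split_fst (hx : IsLocallyDistinct ΞA ΞB x) :
    Function.Injective (splitTuple x).1 :=
  fun _ _ hij => hx.1 (congrArg (· ∘ ((↑) : ΞA → A)) hij)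

theorem injective_split_snd (hx : IsLocallyDistinct ΞA ΞB x) :
    Function.Injective (splitTuple x).2 :=
  fun _ _ hij => hx.2 (congrArg (· ∘ ((↑) : ΞB → B)) hij)

theorem injective_restrictBits (hx : IsLocallyDistinct ΞA ΞB x) :
    Function.Injective (restrictBits ΞA ΞB ∘ x) :=
  fun _ _ hij => hx.1 (congrArg (· ∘ Sum.inl) hij)

theorem eq_comp_of_split (hx : IsLocallyDistinct ΞA ΞB x) {y : Fin k → Bits (A ⊕ B)}
    {σ τ π : Equiv.Perm (Fin k)}
    (hσ : (splitTuple y).1 = (splitTuple x).1 ∘ σ) (hτ : (splitTuple y).2 = (splitTuple x).2 ∘ τ)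
    (hπ : restrictBits ΞA ΞB ∘ y = (restrictBits ΞA ΞB ∘ x) ∘ π) : y = x ∘ π := by
  have hσπ (j : Fin k) : σ j = π j := hx.1 <|
    (congrArg (· ∘ ((↑) : ΞA → A)) (congrFun hσ j)).symm.trans
      (congrArg (· ∘ Sum.inl) (congrFun hπ j))
  have hτπ (j : Fin k) : τ j = π j := hx.2 <|
    (congrArg (· ∘ ((↑) : ΞB → B)) (congrFun hτ j)).symm.trans
      (congrArg (· ∘ Sum.inr) (congrFun hπ j))
  refine splitTuple.injective (Prod.ext ?_ ?_)
  · rw [hσ, funext hσπ]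
    rfl
  · rw [hτ, funext hτπ]
    rfl

end IsLocallyDistinct

theorem sum_not_isLocallyDistinct_le [Fintype A] [DecidableEq A] [Fintype B] [DecidableEq B]
    [DecidablePred (IsLocallyDistinct (k := k) ΞA ΞB)]
    {m : (Fin k → Bits (A ⊕ B)) → ℝ} (hm : 0 ≤ m) {δA δB : ℝ} (hδA₀ : 0 ≤ δA) (hδB₀ : 0 ≤ δB)
    (hδA : ∀ i j, i ≠ j → ∑ x with x i ∘ Sum.inl ∘ ((↑) : ΞA → A) = x j ∘ Sum.inl ∘ (↑), m x ≤ δA)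
    (hδB : ∀ i j, i ≠ j → ∑ x with x i ∘ Sum.inr ∘ ((↑) : ΞB → B) = x j ∘ Sum.inr ∘ (↑), m x ≤ δB) :
    ∑ x with ¬IsLocallyDistinct ΞA ΞB x, m x ≤ k ^ 2 * (δA + δB) := by
  classical
  have hA := sum_not_injective_le (g := (· ∘ Sum.inl ∘ ((↑) : ΞA → A))) hm hδA₀ hδA
  have hB := sum_not_injective_le (g := (· ∘ Sum.inr ∘ ((↑) : ΞB → B))) hm hδB₀ hδB
  rw [Fintype.card_fin] at hA hB
  simp_rw [IsLocallyDistinct, not_and_or]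
  rw [Finset.filter_or, mul_add]
  refine le_trans ?_ (add_le_add hA hB)
  rw [← Finset.sum_union_inter]
  exact le_add_of_nonneg_right (Finset.sum_nonneg fun x _ => hm x)

variable [Fintype A] [DecidableEq A] [Fintype B] [DecidableEq B]

theorem exists_moment_haar_eq_of_isLocallyDistinct (k : ℕ) (ΞA : Finset A) (ΞB : Finset B) :
    ∃ p : ℝ, ∀ x : Fin k → Bits (A ⊕ B), IsLocallyDistinct ΞA ΞB x → ∀ y,
      moment k (haarEnsemble (A ⊕ B)) x y =
        p * rearrangementMatrix (IsLocallyDistinct ΞA ΞB) x y := by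
  obtain ⟨p, hp⟩ := exists_moment_haar_eq_rearrangementMatrix (A ⊕ B) k
  refine ⟨p, fun x hx y => ?_⟩
  simp only [hp x y hx.injective, rearrangementMatrix, Matrix.of_apply, hx, hx.injective]

variable {ν : Measure (Bits (ΞA ⊕ ΞB) → Bool)} [IsProbabilityMeasure ν]

theorem exists_glueMatrix_haar_eq_of_isLocallyDistinct (hν : IsWiseIndependent (2 * k) ν)
    (hk : 2 * k ≤ Nat.card (Bits (ΞA ⊕ ΞB))) :
    ∃ p : ℝ, ∀ x, IsLocallyDistinct ΞA ΞB x → ∀ y,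
      glueMatrix ΞA ΞB ν (moment k (haarEnsemble A)) (moment k (haarEnsemble B)) x y =
        p * rearrangementMatrix (IsLocallyDistinct ΞA ΞB) x y := by
  obtain ⟨pA, hpA⟩ := exists_moment_haar_eq_rearrangementMatrix A k
  obtain ⟨pB, hpB⟩ := exists_moment_haar_eq_rearrangementMatrix B k
  refine ⟨pA * pB, fun x hx y => ?_⟩
  by_cases hperm : ∃ π : Equiv.Perm (Fin k), y = x ∘ π
  · obtain ⟨π, rfl⟩ := hperm
    have hphase : phaseMoment k ν (restrictBits ΞA ΞB ∘ x) (restrictBits ΞA ΞB ∘ x ∘ π) = 1 :=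
      phaseMoment_comp_perm ν _ π
    have hA : (splitTuple (x ∘ π)).1 = (splitTuple x).1 ∘ π := rfl
    have hB : (splitTuple (x ∘ π)).2 = (splitTuple x).2 ∘ π := rfl
    rw [glueMatrix_apply, hphase, hA, hB, hpA _ _ hx.injective_split_fst,
      hpB _ _ hx.injective_split_snd]
    have hone {α : Type} {D : (Fin k → α) → Prop} {z : Fin k → α} (hz : D z) :
        rearrangementMatrix D z (z ∘ π) = 1 := if_pos ⟨hz, π, rfl⟩
    rw [hone hx, hone hx.injective_split_fst, hone hx.injective_split_snd]
    push_cast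
    ring
  · have hT : rearrangementMatrix (IsLocallyDistinct ΞA ΞB) x y = 0 := by
      simp only [rearrangementMatrix, Matrix.of_apply, hperm, and_false, if_false]
    rw [hT, mul_zero, glueMatrix_apply]
    by_contra hne
    obtain ⟨⟨hA, hB⟩, hphase⟩ := (mul_ne_zero_iff.1 hne).imp_left mul_ne_zero_iff.1
    obtain ⟨σ, hσ⟩ := exists_perm_of_moment_haar_ne_zero hA
    obtain ⟨τ, hτ⟩ := exists_perm_of_moment_haar_ne_zero hB
    obtain ⟨π, hπ⟩ := hν.exists_perm_of_phaseMoment_ne_zero hk hx.injective_restrictBits hphase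
    exact hperm ⟨π, hx.eq_comp_of_split hσ hτ hπ⟩

theorem sum_not_isLocallyDistinct_moment_haar_le
    [DecidablePred (IsLocallyDistinct (k := k) ΞA ΞB)] :
    ∑ x with ¬IsLocallyDistinct ΞA ΞB x, (moment k (haarEnsemble (A ⊕ B)) x x).re ≤
      k ^ 2 * (2 / 2 ^ ΞA.card + 2 / 2 ^ ΞB.card) := by
  refine sum_not_isLocallyDistinct_le (fun x => ?_) (by positivity)
    (by positivity) (fun i j hij => ?_) fun i j hij => ?_
  · exact (Complex.nonneg_iff.1 (posSemidef_moment _).diag_nonneg).1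
  · rw [← Fintype.card_coe ΞA]
    exact sum_collision_moment_haar_le (Sum.inl_injective.comp Subtype.val_injective) hij
  · rw [← Fintype.card_coe ΞB]
    exact sum_collision_moment_haar_le (Sum.inr_injective.comp Subtype.val_injective) hij

theorem sum_not_isLocallyDistinct_glueMatrix_haar_le
    [DecidablePred (IsLocallyDistinct (k := k) ΞA ΞB)] :
    ∑ x with ¬IsLocallyDistinct ΞA ΞB x,
      (glueMatrix ΞA ΞB ν (moment k (haarEnsemble A)) (moment k (haarEnsemble B)) x x).re ≤
      k ^ 2 * (2 / 2 ^ ΞA.card + 2 / 2 ^ ΞB.card) := by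
  refine sum_not_isLocallyDistinct_le (fun x => ?_) (by positivity)
    (by positivity) (fun i j hij => ?_) fun i j hij => ?_
  · exact (Complex.nonneg_iff.1
      (posSemidef_glueMatrix (posSemidef_moment _) (posSemidef_moment _)).diag_nonneg).1
  · have hsum := sum_glueMatrix_self (ΞA := ΞA) (ΞB := ΞB) (ν := ν)
      (M := moment k (haarEnsemble A)) (N := moment k (haarEnsemble B))
      (fun a => a i ∘ ((↑) : ΞA → A) = a j ∘ (↑)) fun _ => True
    have htr : ∑ b, moment k (haarEnsemble B) b b = 1 := trace_moment _
    have hcoll := sum_collision_moment_haar_le (Subtype.val_injective (p := (· ∈ ΞA))) hij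
    simp only [and_true, Finset.filter_true, htr, mul_one] at hsum
    rw [← Complex.re_sum, ← hsum, Complex.re_sum, Fintype.card_coe] at hcoll
    exact hcoll
  · have hsum := sum_glueMatrix_self (ΞA := ΞA) (ΞB := ΞB) (ν := ν)
      (M := moment k (haarEnsemble A)) (N := moment k (haarEnsemble B))
      (fun _ => True) fun b => b i ∘ ((↑) : ΞB → B) = b j ∘ (↑)
    have htr : ∑ a, moment k (haarEnsemble A) a a = 1 := trace_moment _
    have hcoll := sum_collision_moment_haar_le (Subtype.val_injective (p := (· ∈ ΞB))) hij
    simp only [true_and, Finset.filter_true, htr, one_mul] at hsum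
    rw [← Complex.re_sum, ← hsum, Complex.re_sum, Fintype.card_coe] at hcoll
    exact hcoll

theorem two_le_of_pow_add_lt {a b k : ℕ} (h : 2 ^ (a + b) < 2 * k) :
    2 ≤ 4 * (k : ℝ) ^ 2 * (1 / 2 ^ a + 1 / 2 ^ b) := by
  have ha : (2 : ℝ) ^ a ≤ 2 * k := by
    exact_mod_cast (Nat.pow_le_pow_right two_pos (Nat.le_add_right a b)).trans h.le
  have hk : (1 : ℝ) ≤ k := by
    exact_mod_cast (by have := Nat.two_pow_pos (a + b); omega : 1 ≤ k)
  calc (2 : ℝ) ≤ 4 * k ^ 2 * (1 / (2 * k)) := by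
        rw [show 4 * (k : ℝ) ^ 2 * (1 / (2 * k)) = 2 * k by field_simp; norm_num]
        linarith
    _ ≤ 4 * k ^ 2 * (1 / 2 ^ a + 1 / 2 ^ b) := by
        gcongr
        exact (one_div_le_one_div_of_le (by positivity) ha).trans
          (le_add_of_nonneg_right (by positivity))

theorem traceNorm_glueMatrix_haar_sub_le (hν : IsWiseIndependent (2 * k) ν) :
    traceNorm (glueMatrix ΞA ΞB ν (moment k (haarEnsemble A)) (moment k (haarEnsemble B)) -
      moment k (haarEnsemble (A ⊕ B))) ≤
        4 * k ^ 2 * (1 / 2 ^ ΞA.card + 1 / 2 ^ ΞB.card) := by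
  classical
  set G := glueMatrix ΞA ΞB ν (moment k (haarEnsemble A)) (moment k (haarEnsemble B))
  set H := moment k (haarEnsemble (A ⊕ B))
  have hG : G.PosSemidef := posSemidef_glueMatrix (posSemidef_moment _) (posSemidef_moment _)
  have hH : H.PosSemidef := posSemidef_moment _
  have hG₁ : G.trace = 1 := by simp only [G, trace_glueMatrix, trace_moment, mul_one]
  have hH₁ : H.trace = 1 := trace_moment _
  have hcard : Nat.card (Bits (ΞA ⊕ ΞB)) = 2 ^ (ΞA.card + ΞB.card) := by simp
  rcases le_or_gt (2 * k) (Nat.card (Bits (ΞA ⊕ ΞB))) with hk | hk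
  · obtain ⟨c, hc⟩ := exists_glueMatrix_haar_eq_of_isLocallyDistinct hν hk
    obtain ⟨d, hd⟩ := exists_moment_haar_eq_of_isLocallyDistinct k ΞA ΞB
    have hT : (rearrangementMatrix (IsLocallyDistinct (k := k) ΞA ΞB)).PosSemidef :=
      posSemidef_rearrangementMatrix isLocallyDistinct_comp_perm
    have hT₀ (x : Fin k → Bits (A ⊕ B)) (hx : ¬IsLocallyDistinct ΞA ΞB x)
        (y : Fin k → Bits (A ⊕ B)) : rearrangementMatrix (IsLocallyDistinct ΞA ΞB) x y = 0 :=
      if_neg (not_and_of_not_left _ hx)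
    exact (traceNorm_sub_le_of_rows hG hH hT (hG₁.trans hH₁.symm) hc hd hT₀
      sum_not_isLocallyDistinct_glueMatrix_haar_le
      sum_not_isLocallyDistinct_moment_haar_le).trans_eq (by ring)
  · refine (traceNorm_sub_le hG hH).trans ?_
    rw [hG₁, hH₁, Complex.one_re, one_add_one_eq_two]
    exact two_le_of_pow_add_lt (hcard ▸ hk)

end HaarGlue

end QDesign

end

open QDesign in
theorem mainTheorem10_general {k : ℕ} {A B : Type} [Fintype A] [DecidableEq A] [Fintype B]
    [DecidableEq B] {ΞA : Finset A} {ΞB : Finset B}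
    {SA : Measure (PureState A)} [IsProbabilityMeasure SA]
    {SB : Measure (PureState B)} [IsProbabilityMeasure SB]
    {ν : Measure (Bits (ΞA ⊕ ΞB) → Bool)} [IsProbabilityMeasure ν]
    (hν : IsWiseIndependent (2 * k) ν) {εA εB : ℝ}
    (hA : IsApproxStateDesign k εA SA) (hB : IsApproxStateDesign k εB SB) :
    IsApproxStateDesign k (εA + εB + 4 * (k : ℝ) ^ 2 * (1 / 2 ^ ΞA.card + 1 / 2 ^ ΞB.card))
      (gluedEnsemble ΞA ΞB SA SB ν) := by
  have hSA := posSemidef_moment (k := k) SA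
  have hSB := posSemidef_moment (k := k) SB
  have hHA := posSemidef_moment (k := k) (haarEnsemble A)
  have hHB := posSemidef_moment (k := k) (haarEnsemble B)
  have hglue := traceNorm_glueMatrix_sub_glueMatrix_le (ΞA := ΞA) (ΞB := ΞB) (ν := ν)
    hSA hHA hSB hHB (trace_moment _) (trace_moment _)
  have hG := (posSemidef_glueMatrix (ΞA := ΞA) (ΞB := ΞB) (ν := ν) hHA hHB).1
  rw [IsApproxStateDesign, moment_gluedEnsemble,
    ← sub_add_sub_cancel _ (glueMatrix ΞA ΞB ν (moment k (haarEnsemble A))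
      (moment k (haarEnsemble B)))]
  exact (traceNorm_add_le ((posSemidef_glueMatrix hSA hSB).1.sub hG)
    (hG.sub (posSemidef_moment _).1)).trans
      (add_le_add (hglue.trans (add_le_add hA hB)) (traceNorm_glueMatrix_haar_sub_le hν))

theorem mainTheorem10 :
    ∃ C : ℝ, 0 < C ∧
      ∀ (k ξ : ℕ) (A B : Type) [Fintype A] [DecidableEq A] [Fintype B] [DecidableEq B]
        (ΞA : Finset A) (ΞB : Finset B), ΞA.card = ξ → ΞB.card = ξ →
      ∀ (SA : Measure (QDesign.PureState A)) [IsProbabilityMeasure SA]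
        (SB : Measure (QDesign.PureState B)) [IsProbabilityMeasure SB]
        (ν : Measure (QDesign.Bits (ΞA ⊕ ΞB) → Bool)) [IsProbabilityMeasure ν],
        QDesign.IsWiseIndependent (2 * k) ν →
      ∀ εA εB : ℝ,
        QDesign.IsApproxStateDesign k εA SA → QDesign.IsApproxStateDesign k εB SB →
        QDesign.IsApproxStateDesign k (εA + εB + C * ((k : ℝ) ^ 2 / 2 ^ ξ))
          (QDesign.gluedEnsemble ΞA ΞB SA SB ν) := by
  refine ⟨8, by norm_num, fun k ξ A B _ _ _ _ ΞA ΞB hΞA hΞB SA _ SB _ ν _ hν εA εB hA hB => ?_⟩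
  exact (mainTheorem10_general hν hA hB).trans_eq (by rw [hΞA, hΞB]; ring)
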